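/- Let $A\in\mathbb R^{d\times d}$ be symmetric, $b\in\mathbb R^d$, and let $\mathcal K_k(A,b)=\operatorname{span}\{b,Ab,\dots,A^{k-1}b\}$. Let $g$ be the grade of $b$ with respect to $A$, i.e. the positive integer with $\dim\mathcal K_k(A,b)=k$ for $1\le k\le g$ and $\dim\mathcal K_k(A,b)=g$ for $k>g$ (so $b\ne0$). Let $x_k$, $d_k$, $\tau_k$, $c_k$, $\gamma^{(1)}_k$ be generated by MINRES in exact arithmetic started at $x_0=0$, that is: $\beta_1=\phi_0=\|b\|$, $v_1=b/\beta_1$, $v_0=d_0=d_{-1}=0$, $c_0=-1$, $s_0=0$, $\delta^{(1)}_1=0$, and for $k=1,2,\dots$ \begin{align*} &\alpha_k=v_k^{\top}Av_k,\quad p_k=Av_k-\beta_kv_{k-1}-\alpha_kv_k,\quad \beta_{k+1}=\|p_k\|,\\ &\delta^{(2)}_k=c_{k-1}\delta^{(1)}_k+s_{k-1}\alpha_k,\quad \gamma^{(1)}_k=s_{k-1}\delta^{(1)}_k-c_{k-1}\alpha_k,\quad \epsilon_{k+1}=s_{k-1}\beta_{k+1},\quad \delta^{(1)}_{k+1}=-c_{k-1}\beta_{k+1},\\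 &\gamma^{(2)}_k=\sqrt{(\gamma^{(1)}_k)^2+\beta_{k+1}^2},\quad c_k=\gamma^{(1)}_k/\gamma^{(2)}_k,\quad s_k=\beta_{k+1}/\gamma^{(2)}_k,\quad \tau_k=c_k\phi_{k-1},\quad \phi_k=s_k\phi_{k-1},\\ &d_k=(v_k-\delta^{(2)}_kd_{k-1}-\epsilon_kd_{k-2})/\gamma^{(2)}_k,\quad x_k=x_{k-1}+\tau_kd_k,\quad v_{k+1}=p_k/\beta_{k+1} \end{align*} (the term $\epsilon_1d_{-1}$ is zero; the algorithm does not break down before iteration $g$, i.e. $\beta_{k+1},\gamma^{(2)}_k\neq0$ for $k<g$). The NPC condition is said to be detected at iteration $k\ge1$ if $c_{k-1}\gamma^{(1)}_k\ge0$. Write $\|x\|_A=x^{\top}Ax$ (without a square root; this need not be a norm) and $m(x)=\tfrac12\langle x,Ax\rangle-\langle b,x\rangle$. Let $0\le K<g$ be such that the NPC condition is not detected at any iteration $1\le k\le K$. Then: \begin{enumerate} \item[(a)] if $Ax^\star=b$, then $\|x^\star-x_k\|_A$ is strictly decreasing in $k\in\{0,\dots,K\}$; \item[(b)] if $Ax^\star=b$,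 then for each $1\le k\le K$ the map $\omega\mapsto\|x^\star-(x_{k-1}+\omega\tau_kd_k)\|_A$ is strictly decreasing on $(-\infty,1]$; \item[(c)] $m(x_k)$ is strictly decreasing in $k\in\{0,\dots,K\}$; \item[(d)] for each $1\le k\le K$ the map $\omega\mapsto m(x_{k-1}+\omega\tau_kd_k)$ is strictly decreasing on $(-\infty,1]$; \item[(e)] $\|x_k\|$ is strictly increasing in $k\in\{0,\dots,K\}$; \item[(f)] for each $1\le k\le K$ the map $\omega\mapsto\|x_{k-1}+\omega\tau_kd_k\|$ is strictly increasing on $[0,\infty)$; \item[(g)] $x_k^{\top}b$ is strictly increasing in $k\in\{0,\dots,K\}$. \end{enumerate} -/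

import Mathlib

/-- The Krylov subspace `𝒦_k(A, b) = span {b, A b, …, A^(k-1) b}`. -/
def krylov {d : ℕ} (A : Matrix (Fin d) (Fin d) ℝ) (b : EuclideanSpace ℝ (Fin d)) (k : ℕ) :
    Submodule ℝ (EuclideanSpace ℝ (Fin d)) :=
  Submodule.span ℝ {y | ∃ i : ℕ, i < k ∧ y = Matrix.toEuclideanLin (A ^ i) b}

/-- `g` is the grade of `b` with respect to `A`: the positive integer with
`dim 𝒦_k(A, b) = k` for `k ≤ g` and `dim 𝒦_k(A, b) = g` for `k > g`. -/
def IsGrade {d : ℕ} (A : Matrix (Fin d) (Fin d) ℝ) (b : EuclideanSpace ℝ (Fin d)) (g : ℕ) : Prop :=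
  0 < g ∧ ∀ k : ℕ, 1 ≤ k → Module.finrank ℝ (krylov A b k) = if k ≤ g then k else g

/-- The quantities that MINRES holds at the end of iteration `k`
(`k = 0` being the initialization). -/
structure MinresState (d : ℕ) where
  /-- the Lanczos vector `v_k` -/
  v : EuclideanSpace ℝ (Fin d)
  /-- the Lanczos vector `v_{k+1}` -/
  vNext : EuclideanSpace ℝ (Fin d)
  /-- the off-diagonal Lanczos coefficient `β_{k+1}` -/
  βNext : ℝ
  /-- `γ_k^{(1)}` -/
  γ₁ : ℝ
  /-- the cosine `c_k` -/
  c : ℝ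
  /-- the sine `s_k` -/
  s : ℝ
  /-- `δ_{k+1}^{(1)}` -/
  δNext : ℝ
  /-- `ε_{k+1}` -/
  εNext : ℝ
  /-- `τ_k` -/
  τ : ℝ
  /-- `φ_k` -/
  φ : ℝ
  /-- the update direction `d_{k-1}` -/
  dirPrev : EuclideanSpace ℝ (Fin d)
  /-- the update direction `d_k` -/
  dir : EuclideanSpace ℝ (Fin d)
  /-- the iterate `x_k` -/
  x : EuclideanSpace ℝ (Fin d)
  /-- the residual `r_k`, in its updated form -/
  r : EuclideanSpace ℝ (Fin d)
  /-- whether the algorithm has returned `x_k` as a solution -/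
  halted : Bool

/-- The initialization of MINRES. The values `γ_0^{(1)}` and `ε_1`, which the algorithm
leaves open, are never relevant (`ε_1` only multiplies `d_{-1} = 0`); they are set to `0`. -/
noncomputable def minresStart {d : ℕ} (b : EuclideanSpace ℝ (Fin d)) : MinresState d where
  v := 0
  vNext := ‖b‖⁻¹ • b
  βNext := ‖b‖
  γ₁ := 0
  c := -1
  s := 0
  δNext := 0
  εNext := 0
  τ := ‖b‖
  φ := ‖b‖
  dirPrev := 0
  dir := 0
  x := 0
  r := b
  halted := false

open Classical in
/-- One iteration of MINRES: the state `S` at the end of iteration `k - 1` is mapped to the one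
at the end of iteration `k`. The algorithm is not stopped when nonpositive curvature is detected
(that return is optional). Once it has returned a solution the state does not change any more. -/
noncomputable def minresStep {d : ℕ} (A : Matrix (Fin d) (Fin d) ℝ) (S : MinresState d) :
    MinresState d :=
  if S.halted = true then S else
  -- Lanczos process: `v` is `v_k`, `S.v` is `v_{k-1}`, `S.βNext` is `β_k`, `β` is `β_{k+1}`
  let v := S.vNext
  let α : ℝ := inner ℝ v (Matrix.toEuclideanLin A v)
  let p := Matrix.toEuclideanLin A v - S.βNext • S.v - α • v
  let β : ℝ := ‖p‖
  -- QR decomposition: `S.δNext` is `δ_k^{(1)}`, `S.c` is `c_{k-1}`, `S.s` is `s_{k-1}`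
  let δ₂ : ℝ := S.c * S.δNext + S.s * α
  let γ₁ : ℝ := S.s * S.δNext - S.c * α
  let ε : ℝ := S.s * β
  let δ : ℝ := -S.c * β
  let γ₂ : ℝ := Real.sqrt (γ₁ ^ 2 + β ^ 2)
  if γ₂ ≠ 0 then
    -- update: `S.dir` is `d_{k-1}`, `S.dirPrev` is `d_{k-2}`, `S.εNext` is `ε_k`
    let c : ℝ := γ₁ / γ₂
    let s : ℝ := β / γ₂
    let τ : ℝ := c * S.φ
    let φ : ℝ := s * S.φ
    let dir := γ₂⁻¹ • (v - δ₂ • S.dir - S.εNext • S.dirPrev)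
    let x := S.x + τ • dir
    if β ≠ 0 then
      { v := v, vNext := β⁻¹ • p, βNext := β, γ₁ := γ₁, c := c, s := s, δNext := δ, εNext := ε,
        τ := τ, φ := φ, dirPrev := S.dir, dir := dir, x := x,
        r := s ^ 2 • S.r - (φ * c) • (β⁻¹ • p), halted := false }
    else
      { v := v, vNext := 0, βNext := β, γ₁ := γ₁, c := c, s := s, δNext := δ, εNext := ε,
        τ := τ, φ := φ, dirPrev := S.dir, dir := dir, x := x, r := 0, halted := true }
  else
    { v := v, vNext := 0, βNext := β, γ₁ := γ₁, c := 0, s := 1, δNext := δ, εNext := ε,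
      τ := 0, φ := S.φ, dirPrev := S.dir, dir := 0, x := S.x, r := S.r, halted := true }

/-- The state of MINRES, applied to `A` and `b`, at the end of iteration `k`. -/
noncomputable def minres {d : ℕ} (A : Matrix (Fin d) (Fin d) ℝ) (b : EuclideanSpace ℝ (Fin d)) :
    ℕ → MinresState d
  | 0 => minresStart b
  | k + 1 => minresStep A (minres A b k)

/-- The NPC condition `c_{k-1} γ_k^{(1)} ≥ 0` at iteration `k` (for `k ≥ 1`). -/
def NPCDetected {d : ℕ} (A : Matrix (Fin d) (Fin d) ℝ) (b : EuclideanSpace ℝ (Fin d)) (k : ℕ) :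
    Prop :=
  0 ≤ (minres A b (k - 1)).c * (minres A b k).γ₁

/-- The point `x_{k-1} + ω τ_k d_k` (for `k ≥ 1`). -/
noncomputable def minresSegment {d : ℕ} (A : Matrix (Fin d) (Fin d) ℝ)
    (b : EuclideanSpace ℝ (Fin d)) (k : ℕ) (ω : ℝ) : EuclideanSpace ℝ (Fin d) :=
  (minres A b (k - 1)).x + (ω * (minres A b k).τ) • (minres A b k).dir

/-- `‖x‖_A = xᵀ A x` (without a square root; not a norm unless `A` is positive definite). -/
noncomputable def energy {d : ℕ} (A : Matrix (Fin d) (Fin d) ℝ) (x : EuclideanSpace ℝ (Fin d)) :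
    ℝ :=
  inner ℝ x (Matrix.toEuclideanLin A x)

/-- The quadratic model `m(x) = ⟨x, A x⟩ / 2 - ⟨b, x⟩`. -/
noncomputable def quadModel {d : ℕ} (A : Matrix (Fin d) (Fin d) ℝ)
    (b x : EuclideanSpace ℝ (Fin d)) : ℝ :=
  inner ℝ x (Matrix.toEuclideanLin A x) / 2 - inner ℝ b x

/-! While no nonpositive curvature is detected, MINRES behaves like the conjugate residual method.
Write the residual as `φ w` with `w` a unit vector, and let `u = τ d` be the last update. The next
update is `u' = a w + e u` with `a > 0` and `e ≥ 0` (`Invariant.update_eq`). Moreover `⟪w, T u⟫ =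
0`, and `⟪w, T w⟫ = -c γ₁'` is positive exactly when the NPC test fails.

The next residual direction is `w' = s' w - c' v'`, where the new Lanczos vector `v'` is orthogonal
to everything built so far. Pairing older vectors with `w'` thus only rescales by `s' > 0`, and all
the needed signs follow by induction (`signs_succ`). Monotonicity is then a one-variable computation
along each segment, and `energy_sub` reduces the energy to the quadratic model. The grade enters
only to exclude an early breakdown (`isMinresRun_minres`). -/

section Step

/-! ### A single iteration. -/

variable {d : ℕ}

/-- The relations between the states `S`, `S'` before and after an iteration of MINRES with
`β ≠ 0`, for the operator `T`. -/
structure IsMinresStep (T : EuclideanSpace ℝ (Fin d) →ₗ[ℝ] EuclideanSpace ℝ (Fin d))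
    (S S' : MinresState d) (α γ₂ : ℝ) : Prop where
  v_eq : S'.v = S.vNext
  α_eq : α = inner ℝ S.vNext (T S.vNext)
  lanczos : T S.vNext = S.βNext • S.v + α • S.vNext + S'.βNext • S'.vNext
  norm_vNext : ‖S'.vNext‖ = 1
  β_pos : 0 < S'.βNext
  γ₂_pos : 0 < γ₂
  γ₁_eq : S'.γ₁ = S.s * S.δNext - S.c * α
  ε_eq : S'.εNext = S.s * S'.βNext
  δ_eq : S'.δNext = -S.c * S'.βNext
  c_mul : S'.c * γ₂ = S'.γ₁
  s_mul : S'.s * γ₂ = S'.βNext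
  sq_add_sq : S'.c ^ 2 + S'.s ^ 2 = 1
  τ_eq : S'.τ = S'.c * S.φ
  φ_eq : S'.φ = S'.s * S.φ
  dirPrev_eq : S'.dirPrev = S.dir
  dir_smul : S.vNext =
    γ₂ • S'.dir + (S.c * S.δNext + S.s * α) • S.dir + S.εNext • S.dirPrev
  x_eq : S'.x = S.x + S'.τ • S'.dir

lemma IsMinresStep.s_pos {T : EuclideanSpace ℝ (Fin d) →ₗ[ℝ] EuclideanSpace ℝ (Fin d)}
    {S S' : MinresState d} {α γ₂ : ℝ} (h : IsMinresStep T S S' α γ₂) : 0 < S'.s := by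
  have h1 := h.s_mul ▸ h.β_pos
  exact (pos_iff_pos_of_mul_pos h1).2 h.γ₂_pos

/-- An iteration either satisfies `A v = β v' + α v` for the last Lanczos vectors `v`, `v'`,
or it is a proper step, after which MINRES goes on. -/
lemma minresStep_spec (A : Matrix (Fin d) (Fin d) ℝ) (S : MinresState d)
    (hS : S.halted = false) :
    (∃ α : ℝ, Matrix.toEuclideanLin A S.vNext = S.βNext • S.v + α • S.vNext) ∨
    ((minresStep A S).halted = false ∧
      ∃ α γ₂, IsMinresStep (Matrix.toEuclideanLin A) S (minresStep A S) α γ₂) := by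
  set T := Matrix.toEuclideanLin A with hT
  set α : ℝ := inner ℝ S.vNext (T S.vNext) with hα
  set p := T S.vNext - S.βNext • S.v - α • S.vNext with hp
  by_cases hβ : ‖p‖ = 0
  · left
    refine ⟨α, ?_⟩
    have h0 : p = 0 := norm_eq_zero.1 hβ
    rw [hp] at h0
    linear_combination (norm := module) h0
  right
  have hβ0 : 0 < ‖p‖ := lt_of_le_of_ne (norm_nonneg _) (Ne.symm hβ)
  set γ₁ : ℝ := S.s * S.δNext - S.c * α with hγ₁
  -- A nonzero `‖p‖` already forces `γ₂ > 0`, so both tests in `minresStep` succeed.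
  have hsum : 0 < γ₁ ^ 2 + ‖p‖ ^ 2 := by positivity
  set γ₂ : ℝ := Real.sqrt (γ₁ ^ 2 + ‖p‖ ^ 2) with hγ₂
  have hγ₂0 : 0 < γ₂ := Real.sqrt_pos.2 hsum
  have hγ₂sq : γ₂ ^ 2 = γ₁ ^ 2 + ‖p‖ ^ 2 := Real.sq_sqrt hsum.le
  have key : minresStep A S =
      { v := S.vNext, vNext := ‖p‖⁻¹ • p, βNext := ‖p‖, γ₁ := γ₁, c := γ₁ / γ₂, s := ‖p‖ / γ₂,
        δNext := -S.c * ‖p‖, εNext := S.s * ‖p‖, τ := γ₁ / γ₂ * S.φ, φ := ‖p‖ / γ₂ * S.φ,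
        dirPrev := S.dir,
        dir := γ₂⁻¹ • (S.vNext - (S.c * S.δNext + S.s * α) • S.dir - S.εNext • S.dirPrev),
        x := S.x + (γ₁ / γ₂ * S.φ) •
          γ₂⁻¹ • (S.vNext - (S.c * S.δNext + S.s * α) • S.dir - S.εNext • S.dirPrev),
        r := (‖p‖ / γ₂) ^ 2 • S.r - (‖p‖ / γ₂ * S.φ * (γ₁ / γ₂)) • (‖p‖⁻¹ • p),
        halted := false } := by
    unfold minresStep
    rw [if_neg (by simp [hS])]
    dsimp only
    rw [if_pos hγ₂0.ne', if_pos hβ]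
  rw [key]
  refine ⟨rfl, α, γ₂, ?_⟩
  constructor <;> (try rfl) <;> try dsimp only
  · rw [smul_inv_smul₀ hβ, hp]; abel
  · rw [norm_smul, norm_inv, norm_norm, inv_mul_cancel₀ hβ]
  · exact hβ0
  · exact hγ₂0
  · exact div_mul_cancel₀ _ hγ₂0.ne'
  · exact div_mul_cancel₀ _ hγ₂0.ne'
  · rw [div_pow, div_pow, ← add_div, ← hγ₂sq]
    exact div_self (pow_ne_zero 2 hγ₂0.ne')
  · rw [smul_inv_smul₀ hγ₂0.ne']; abel

end Step

/-! ### Lanczos vectors and their orthogonality. -/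

section Run

variable {d : ℕ} (T : EuclideanSpace ℝ (Fin d) →ₗ[ℝ] EuclideanSpace ℝ (Fin d))
  (S : ℕ → MinresState d)

/-- The span of the Lanczos vectors `v₁, …, v_n`. -/
def lanczosSpan (n : ℕ) : Submodule ℝ (EuclideanSpace ℝ (Fin d)) :=
  Submodule.span ℝ ((fun i => (S i).vNext) '' Set.Iio n)

lemma vNext_mem_lanczosSpan {i n : ℕ} (h : i < n) : (S i).vNext ∈ lanczosSpan S n :=
  Submodule.subset_span ⟨i, h, rfl⟩

lemma lanczosSpan_mono {m n : ℕ} (h : m ≤ n) : lanczosSpan S m ≤ lanczosSpan S n :=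
  Submodule.span_mono (Set.image_mono (Set.Iio_subset_Iio h))

lemma finrank_lanczosSpan_le (n : ℕ) : Module.finrank ℝ (lanczosSpan S n) ≤ n := by
  classical
  have h : (fun i => (S i).vNext) '' Set.Iio n =
      ((Finset.range n).image fun i => (S i).vNext : Finset _) := by
    ext y; simp
  unfold lanczosSpan
  rw [h]
  exact (finrank_span_finset_le_card _).trans (Finset.card_image_le.trans (by simp))

/-- The residual of MINRES, normalized. -/
noncomputable def unitResidual : ℕ → EuclideanSpace ℝ (Fin d)
  | 0 => (S 0).vNext
  | n + 1 => (S (n + 1)).s • unitResidual n - (S (n + 1)).c • (S (n + 1)).vNext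

/-- `S 0, …, S N` are successive states of MINRES that has not halted. -/
structure IsMinresRun (b : EuclideanSpace ℝ (Fin d)) (N : ℕ) : Prop where
  start : S 0 = minresStart b
  b_ne : b ≠ 0
  step : ∀ n < N, ∃ α γ₂, IsMinresStep T (S n) (S (n + 1)) α γ₂

namespace IsMinresRun

variable {T S} {b : EuclideanSpace ℝ (Fin d)} {N : ℕ}

lemma v_mem (h : IsMinresRun T S b N) {n : ℕ} (hn : n ≤ N) : (S n).v ∈ lanczosSpan S n := by
  cases n with
  | zero => rw [h.start]; exact Submodule.zero_mem _
  | succ n =>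
    obtain ⟨α, γ₂, hs⟩ := h.step n hn
    rw [hs.v_eq]
    exact vNext_mem_lanczosSpan S n.lt_succ_self

lemma norm_vNext (h : IsMinresRun T S b N) {n : ℕ} (hn : n ≤ N) : ‖(S n).vNext‖ = 1 := by
  cases n with
  | zero =>
    rw [h.start]
    simp [minresStart, norm_smul, h.b_ne]
  | succ n =>
    obtain ⟨α, γ₂, hs⟩ := h.step n hn
    exact hs.norm_vNext

lemma apply_vNext_mem (h : IsMinresRun T S b N) {n : ℕ} (hn : n < N) :
    T (S n).vNext ∈ lanczosSpan S (n + 2) := by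
  obtain ⟨α, γ₂, hs⟩ := h.step n hn
  rw [hs.lanczos]
  refine add_mem (add_mem (Submodule.smul_mem _ _ ?_) (Submodule.smul_mem _ _ ?_))
    (Submodule.smul_mem _ _ ?_)
  · exact lanczosSpan_mono S (by lia) (h.v_mem hn.le)
  · exact vNext_mem_lanczosSpan S (by lia)
  · exact vNext_mem_lanczosSpan S (by lia)

lemma inner_eq_zero_of_forall {n : ℕ} {z y : EuclideanSpace ℝ (Fin d)}
    (h : ∀ i < n, inner ℝ (S i).vNext z = (0 : ℝ)) (hy : y ∈ lanczosSpan S n) :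
    inner ℝ y z = (0 : ℝ) := by
  induction hy using Submodule.span_induction with
  | mem y hy => obtain ⟨i, hi, rfl⟩ := hy; exact h i hi
  | zero => exact inner_zero_left _
  | add y y' _ _ h1 h2 => rw [inner_add_left, h1, h2, add_zero]
  | smul a y _ h1 => rw [real_inner_smul_left, h1, mul_zero]

/-- By symmetry `T` can be moved onto the earlier vector, where the recurrence reaches only one
index further. So only the two latest vectors can interfere, and the `α` and `β` terms remove
exactly these. -/
lemma inner_vNext (h : IsMinresRun T S b N) (hT : T.IsSymmetric) {n : ℕ} (hn : n ≤ N) :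
    ∀ i < n, inner ℝ (S i).vNext (S n).vNext = (0 : ℝ) := by
  induction n using Nat.strong_induction_on with
  | _ n ih =>
  intro i hi
  obtain ⟨n, rfl⟩ : ∃ m, n = m + 1 := ⟨n - 1, by lia⟩
  obtain ⟨α, γ₂, hs⟩ := h.step n hn
  have ihn : ∀ y ∈ lanczosSpan S n, inner ℝ y (S n).vNext = (0 : ℝ) := fun y hy =>
    inner_eq_zero_of_forall (ih n n.lt_succ_self (by lia)) hy
  have hnn : inner ℝ (S n).vNext (S n).vNext = (1 : ℝ) := by
    rw [real_inner_self_eq_norm_sq, h.norm_vNext (by lia), one_pow]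
  have hl := congrArg (fun z => (inner ℝ (S i).vNext z : ℝ)) hs.lanczos
  simp only [inner_add_right, real_inner_smul_right] at hl
  suffices h0 : (S (n + 1)).βNext * inner ℝ (S i).vNext (S (n + 1)).vNext = (0 : ℝ) from
    (mul_eq_zero.1 h0).resolve_left hs.β_pos.ne'
  obtain rfl | hin := (Nat.lt_succ_iff.1 hi).eq_or_lt
  · have h1 := ihn _ (h.v_mem (by lia))
    rw [real_inner_comm] at h1
    rw [h1, hnn, ← hs.α_eq] at hl
    linarith
  · have h1 := ihn _ (vNext_mem_lanczosSpan S hin)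
    have h2 : inner ℝ (S i).vNext (T (S n).vNext) = (S n).βNext * inner ℝ (S i).vNext (S n).v := by
      rw [← hT]
      obtain ⟨α', γ₂', hs'⟩ := h.step i (by lia)
      -- For adjacent indices both sides equal `β`; otherwise both vanish.
      obtain rfl | hin' := (Nat.succ_le_of_lt hin).eq_or_lt
      · rw [hs'.lanczos, inner_add_left, inner_add_left, real_inner_smul_left,
          real_inner_smul_left, real_inner_smul_left, ihn _ (vNext_mem_lanczosSpan S hin),
          ihn _ (lanczosSpan_mono S (Nat.le_succ i) (h.v_mem (by lia))), hs'.v_eq,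
          real_inner_self_eq_norm_sq, real_inner_self_eq_norm_sq, h.norm_vNext (by lia),
          h.norm_vNext (by lia)]
        ring
      · rw [ihn _ (lanczosSpan_mono S hin' (h.apply_vNext_mem (by lia)))]
        obtain ⟨m, rfl⟩ : ∃ m, n = m + 1 := ⟨n - 1, by lia⟩
        obtain ⟨α'', γ₂'', hs''⟩ := h.step m (by lia)
        rw [hs''.v_eq, ih m (by lia) (by lia) i (by lia), mul_zero]
    rw [h1, h2] at hl
    linarith

lemma inner_vNext_of_mem (h : IsMinresRun T S b N) (hT : T.IsSymmetric) {n : ℕ} (hn : n ≤ N)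
    {y : EuclideanSpace ℝ (Fin d)} (hy : y ∈ lanczosSpan S n) :
    inner ℝ y (S n).vNext = (0 : ℝ) :=
  inner_eq_zero_of_forall (h.inner_vNext hT hn) hy

lemma unitResidual_mem (n : ℕ) : unitResidual S n ∈ lanczosSpan S (n + 1) := by
  induction n with
  | zero => exact vNext_mem_lanczosSpan S Nat.one_pos
  | succ n ih =>
    exact sub_mem (Submodule.smul_mem _ _ (lanczosSpan_mono S (Nat.le_succ _) ih))
      (Submodule.smul_mem _ _ (vNext_mem_lanczosSpan S (Nat.lt_succ_self _)))

lemma b_mem (h : IsMinresRun T S b N) (n : ℕ) : b ∈ lanczosSpan S (n + 1) := by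
  have h0 : b = ‖b‖ • (S 0).vNext := by
    rw [h.start]
    exact (smul_inv_smul₀ (norm_ne_zero_iff.2 h.b_ne) b).symm
  rw [h0]
  exact Submodule.smul_mem _ _ (vNext_mem_lanczosSpan S n.succ_pos)

lemma dir_mem (h : IsMinresRun T S b N) {n : ℕ} (hn : n ≤ N) :
    (S n).dir ∈ lanczosSpan S n ∧ (S n).dirPrev ∈ lanczosSpan S n ∧
      (S n).x ∈ lanczosSpan S n := by
  induction n with
  | zero => rw [h.start]; exact ⟨zero_mem _, zero_mem _, zero_mem _⟩
  | succ n ih =>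
    obtain ⟨h1, h2, h3⟩ := ih (by lia)
    obtain ⟨α, γ₂, hs⟩ := h.step n hn
    have hle := lanczosSpan_mono S (Nat.le_succ n)
    have hd : (S (n + 1)).dir ∈ lanczosSpan S (n + 1) := by
      have h4 : γ₂ • (S (n + 1)).dir = (S n).vNext
          - ((S n).c * (S n).δNext + (S n).s * α) • (S n).dir
          - (S n).εNext • (S n).dirPrev := by
        rw [hs.dir_smul]; abel
      have h5 : (S (n + 1)).dir = γ₂⁻¹ • γ₂ • (S (n + 1)).dir :=
        (inv_smul_smul₀ hs.γ₂_pos.ne' _).symm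
      rw [h5, h4]
      exact Submodule.smul_mem _ _ (sub_mem (sub_mem
        (vNext_mem_lanczosSpan S n.lt_succ_self) (Submodule.smul_mem _ _ (hle h1)))
        (Submodule.smul_mem _ _ (hle h2)))
    refine ⟨hd, ?_, ?_⟩
    · rw [hs.dirPrev_eq]; exact hle h1
    · rw [hs.x_eq]; exact add_mem (hle h3) (Submodule.smul_mem _ _ hd)

/-! ### Algebra of the QR factorization. -/

/-- The algebraic invariants of the QR factorization in MINRES. -/
structure Invariant (T : EuclideanSpace ℝ (Fin d) →ₗ[ℝ] EuclideanSpace ℝ (Fin d))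
    (b : EuclideanSpace ℝ (Fin d)) (S : MinresState d) (w : EuclideanSpace ℝ (Fin d)) : Prop where
  sq_add_sq : S.c ^ 2 + S.s ^ 2 = 1
  vNext_eq : S.vNext = S.s • T S.dir - S.c • w
  v_smul : S.βNext • S.v = S.εNext • T S.dirPrev + S.δNext • (S.c • T S.dir + S.s • w)
  add_smul_vNext : w + S.c • S.vNext = S.δNext • S.dir + (S.c * S.εNext) • S.dirPrev
  residual : b - T S.x = S.φ • w
  smul_dir : (S.c * S.φ) • S.dir = (S.s * S.τ) • S.dir

section Step

variable {S S' : MinresState d} {w : EuclideanSpace ℝ (Fin d)} {α γ₂ : ℝ}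

/-- Apply `T` to the recursion for the direction. The `v_smul` invariant cancels the `T d_{k-2}`
term, and `vNext_eq` cancels `T d_{k-1}`, leaving `γ₁` times `w` plus `β` times the new Lanczos
vector. -/
lemma Invariant.apply_dir (hs : IsMinresStep T S S' α γ₂) (hi : Invariant T b S w) :
    T S'.dir = S'.c • w + S'.s • S'.vNext := by
  have h1 := congrArg T hs.dir_smul
  rw [hs.lanczos, hi.v_smul] at h1
  simp only [map_add, map_smul] at h1
  have h2 : γ₂ • T S'.dir = γ₂ • (S'.c • w + S'.s • S'.vNext) := by
    rw [smul_add, smul_smul, smul_smul, mul_comm γ₂, hs.c_mul, mul_comm γ₂, hs.s_mul, hs.γ₁_eq]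
    have h3 := hi.vNext_eq
    linear_combination (norm := module) -h1 + α • h3
  exact smul_right_injective _ hs.γ₂_pos.ne' h2

lemma Invariant.eq_dir (hs : IsMinresStep T S S' α γ₂) (hi : Invariant T b S w) :
    w = -(S.c * γ₂) • S'.dir + (S.s * S'.γ₁) • S.dir := by
  have h1 := hi.add_smul_vNext
  rw [hs.dir_smul] at h1
  have h2 : S.s ^ 2 = 1 - S.c ^ 2 := by linear_combination hi.sq_add_sq
  have h3 : S.s * S'.γ₁ = S.δNext - S.c * (S.c * S.δNext + S.s * α) := by
    rw [hs.γ₁_eq]; linear_combination S.δNext * h2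
  rw [h3]
  linear_combination (norm := module) h1

/-- The pair `(T d', w')` is the image of `(w, v')` under the reflection with rows `(c', s')` and
`(s', -c')`. It is its own inverse, which gives `vNext_eq` and identifies `c' T d' + s' w'` with the
old `w`. -/
lemma Invariant.succ (hs : IsMinresStep T S S' α γ₂) (hi : Invariant T b S w) :
    Invariant T b S' (S'.s • w - S'.c • S'.vNext) := by
  have hd := hi.apply_dir hs
  have hw := hi.eq_dir hs
  have h2 : S'.s ^ 2 = 1 - S'.c ^ 2 := by linear_combination hs.sq_add_sq
  refine ⟨hs.sq_add_sq, ?_, ?_, ?_, ?_, ?_⟩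
  · rw [hd]
    linear_combination (norm := module) congrArg (· • S'.vNext) hs.sq_add_sq.symm
  · rw [hd, hs.dirPrev_eq, hs.ε_eq, hs.δ_eq, hs.v_eq, hi.vNext_eq]
    linear_combination (norm := module)
      (S'.βNext * S.c) • congrArg (· • w) hs.sq_add_sq
  · have h3 : S'.s • w = -(S.c * S'.βNext) • S'.dir + (S.s * (S'.c * S'.βNext)) • S.dir := by
      conv_lhs => rw [hw]
      rw [← hs.c_mul, ← hs.s_mul]
      module
    rw [hs.dirPrev_eq, hs.ε_eq, hs.δ_eq]
    linear_combination (norm := module) h3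
  · rw [hs.x_eq, map_add, map_smul, hd, hs.τ_eq, hs.φ_eq]
    have h4 := hi.residual
    linear_combination (norm := module) h4 - S.φ • congrArg (· • w) hs.sq_add_sq
  · rw [hs.τ_eq, hs.φ_eq]
    module

/-- This is `eq_dir` solved for the new direction. The sign hypothesis makes the coefficient of `w`
positive when `φ > 0`; the other coefficient is a square. -/
lemma Invariant.update_eq (hs : IsMinresStep T S S' α γ₂) (hi : Invariant T b S w)
    (hc : S.c * S'.γ₁ < 0) :
    S'.τ • S'.dir = (-(S.c * S'.γ₁) * S.φ / (S.c * γ₂) ^ 2) • w +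
      (S'.c * S.s / S.c) ^ 2 • (S.τ • S.dir) := by
  have hc0 : S.c ≠ 0 := fun h => by simp [h] at hc
  have hγ := hs.γ₂_pos.ne'
  have hw := hi.eq_dir hs
  -- The invariant `smul_dir` keeps the factor `d` because `c φ = s τ` is false at the
  -- initialization, where `d = 0`.
  have h1 : S.φ • S.dir = S.c⁻¹ • (S.s * S.τ) • S.dir := by
    rw [← hi.smul_dir, mul_smul, inv_smul_smul₀ hc0]
  have h2 : S'.τ • S'.dir = (-(S.c * S'.γ₁) * S.φ / (S.c * γ₂) ^ 2) • w +
      (S'.γ₁ * S.s * S'.γ₁ / (S.c * γ₂ ^ 2)) • (S.φ • S.dir) := by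
    conv_rhs => rw [hw]
    rw [hs.τ_eq, ← hs.c_mul]
    match_scalars
    · field_simp
    · field_simp
      ring
  rw [h2, h1, ← hs.c_mul]
  match_scalars <;> field_simp

end Step

lemma invariant (h : IsMinresRun T S b N) {n : ℕ} (hn : n ≤ N) :
    Invariant T b (S n) (unitResidual S n) := by
  induction n with
  | zero =>
    have hb : ‖b‖ ≠ 0 := norm_ne_zero_iff.2 h.b_ne
    constructor <;> simp [unitResidual, h.start, minresStart, hb]
  | succ n ih =>
    obtain ⟨α, γ₂, hs⟩ := h.step n hn
    exact (ih (by lia)).succ hs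

/-- The old `w` and the new Lanczos vector are orthonormal, and the reflection preserves this. -/
lemma norm_unitResidual (h : IsMinresRun T S b N) (hT : T.IsSymmetric) {n : ℕ} (hn : n ≤ N) :
    inner ℝ (unitResidual S n) (unitResidual S n) = (1 : ℝ) ∧
      inner ℝ (unitResidual S n) (T (S n).dir) = (0 : ℝ) := by
  induction n with
  | zero =>
    constructor
    · rw [unitResidual, real_inner_self_eq_norm_sq, h.norm_vNext hn, one_pow]
    · simp [h.start, minresStart]
  | succ n ih =>
    obtain ⟨h1, -⟩ := ih (by lia)
    obtain ⟨α, γ₂, hs⟩ := h.step n hn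
    have h2 := h.inner_vNext_of_mem hT hn (unitResidual_mem n)
    have h3 := h2
    rw [real_inner_comm] at h3
    have h4 : inner ℝ (S (n + 1)).vNext (S (n + 1)).vNext = (1 : ℝ) := by
      rw [real_inner_self_eq_norm_sq, h.norm_vNext hn, one_pow]
    rw [(h.invariant (by lia)).apply_dir hs]
    simp only [unitResidual, inner_add_right, inner_sub_left, inner_sub_right,
      real_inner_smul_left, real_inner_smul_right, h1, h2, h3, h4]
    constructor
    · linear_combination hs.sq_add_sq
    · ring

lemma φ_pos (h : IsMinresRun T S b N) {n : ℕ} (hn : n ≤ N) : 0 < (S n).φ := by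
  induction n with
  | zero => rw [h.start]; exact norm_pos_iff.2 h.b_ne
  | succ n ih =>
    obtain ⟨α, γ₂, hs⟩ := h.step n hn
    rw [hs.φ_eq]
    exact mul_pos hs.s_pos (ih (by lia))

/-! ### Propagation of signs. -/

/-- The signs of inner products on which the monotonicity properties rest: `u` is the last
update, `w` the normalized residual and `x` the iterate. -/
structure Signs (T : EuclideanSpace ℝ (Fin d) →ₗ[ℝ] EuclideanSpace ℝ (Fin d))
    (b u w x : EuclideanSpace ℝ (Fin d)) : Prop where
  u_apply_u : 0 ≤ (inner ℝ u (T u) : ℝ)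
  u_w : 0 ≤ (inner ℝ u w : ℝ)
  u_x : 0 ≤ (inner ℝ u x : ℝ)
  w_x : 0 ≤ (inner ℝ w x : ℝ)
  u_b : 0 ≤ (inner ℝ u b : ℝ)
  w_b : 0 < (inner ℝ w b : ℝ)

/-- The properties of an update `u` made at the iterate `x`. -/
structure GoodUpdate (T : EuclideanSpace ℝ (Fin d) →ₗ[ℝ] EuclideanSpace ℝ (Fin d))
    (b x u : EuclideanSpace ℝ (Fin d)) : Prop where
  ne_zero : u ≠ 0
  inner_x : 0 ≤ (inner ℝ u x : ℝ)
  inner_apply : 0 ≤ (inner ℝ u (T u) : ℝ)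
  inner_residual : 0 < (inner ℝ u (b - T (x + u)) : ℝ)
  inner_b : 0 < (inner ℝ u b : ℝ)

lemma signs_succ (h : IsMinresRun T S b N) (hT : T.IsSymmetric) {n : ℕ} (hn : n < N)
    (hc : (S n).c * (S (n + 1)).γ₁ < 0)
    (hp : Signs T b ((S n).τ • (S n).dir) (unitResidual S n) (S n).x) :
    Signs T b ((S (n + 1)).τ • (S (n + 1)).dir) (unitResidual S (n + 1)) (S (n + 1)).x ∧
      GoodUpdate T b (S n).x ((S (n + 1)).τ • (S (n + 1)).dir) := by
  obtain ⟨α, γ₂, hs⟩ := h.step n hn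
  have hi := h.invariant hn.le
  have hi' := h.invariant (Nat.succ_le_of_lt hn)
  have hu := hi.update_eq hs hc
  obtain ⟨hww, hwd⟩ := h.norm_unitResidual hT hn.le
  have hVw := h.inner_vNext_of_mem hT hn (unitResidual_mem n)
  have hVd := h.inner_vNext_of_mem hT hn (h.dir_mem hn).1
  have hVx := h.inner_vNext_of_mem hT hn (h.dir_mem hn).2.2
  have hVb := h.inner_vNext_of_mem hT hn (h.b_mem n)
  have hs0 := hs.s_pos
  have hφ := h.φ_pos hn.le
  have hφ' := h.φ_pos (Nat.succ_le_of_lt hn)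
  have hc0 : (S n).c ≠ 0 := fun h => by simp [h] at hc
  have hγ := hs.γ₂_pos
  have hx := hs.x_eq
  have hr := hi'.residual
  -- The NPC quantity is minus the curvature of `T` along the residual direction.
  have hTw : inner ℝ (unitResidual S n) (T (unitResidual S n)) = -((S n).c * (S (n + 1)).γ₁) := by
    have h1 := congrArg T (hi.eq_dir hs)
    rw [map_add, map_smul, map_smul, hi.apply_dir hs] at h1
    rw [h1]
    simp only [inner_add_right, real_inner_smul_right, hww, hVw, hwd]
    rw [← hs.c_mul]; ring
  set a : ℝ := -((S n).c * (S (n + 1)).γ₁) * (S n).φ / ((S n).c * γ₂) ^ 2 with ha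
  have ha0 : 0 < a := by
    have : 0 < -((S n).c * (S (n + 1)).γ₁) := by linarith
    positivity
  set e : ℝ := ((S (n + 1)).c * (S n).s / (S n).c) ^ 2 with he
  have he0 : 0 ≤ e := sq_nonneg _
  set u' := (S (n + 1)).τ • (S (n + 1)).dir with hu'
  set u := (S n).τ • (S n).dir with hu0
  have hwu : inner ℝ (unitResidual S n) (T u) = (0 : ℝ) := by
    rw [hu0, map_smul, real_inner_smul_right, hwd, mul_zero]
  have hVu' : inner ℝ u' (S (n + 1)).vNext = (0 : ℝ) := by
    rw [hu', real_inner_smul_left, hVd, mul_zero]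
  have hw' : ∀ y, inner ℝ y (S (n + 1)).vNext = (0 : ℝ) →
      inner ℝ y (unitResidual S (n + 1)) =
        ((S (n + 1)).s * inner ℝ y (unitResidual S n) : ℝ) := fun y hy => by
    rw [unitResidual, inner_sub_right, real_inner_smul_right, real_inner_smul_right, hy,
      mul_zero, sub_zero]
  have huw : 0 < (inner ℝ u' (unitResidual S n) : ℝ) := by
    rw [hu, inner_add_left, real_inner_smul_left, real_inner_smul_left, hww]
    have := mul_nonneg he0 hp.u_w
    linarith
  have huTu : 0 ≤ (inner ℝ u' (T u') : ℝ) := by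
    -- With both cross terms zero, `⟪u', T u'⟫ = a² ⟪w, T w⟫ + e² ⟪u, T u⟫`.
    have h1 : inner ℝ u (T (unitResidual S n)) = (0 : ℝ) := by
      rw [← hT, real_inner_comm, hwu]
    rw [hu]
    simp only [map_add, map_smul, inner_add_left, inner_add_right, real_inner_smul_left,
      real_inner_smul_right, hwu, h1, hTw]
    have h2 : 0 < a * (a * -((S n).c * (S (n + 1)).γ₁)) :=
      mul_pos ha0 (mul_pos ha0 (by linarith))
    have h3 := mul_nonneg he0 (mul_nonneg he0 hp.u_apply_u)
    linarith
  have hux : 0 ≤ (inner ℝ u' (S n).x : ℝ) := by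
    rw [hu, inner_add_left, real_inner_smul_left, real_inner_smul_left]
    exact add_nonneg (mul_nonneg ha0.le hp.w_x) (mul_nonneg he0 hp.u_x)
  have hub : 0 < (inner ℝ u' b : ℝ) := by
    rw [hu, inner_add_left, real_inner_smul_left, real_inner_smul_left]
    exact add_pos_of_pos_of_nonneg (mul_pos ha0 hp.w_b) (mul_nonneg he0 hp.u_b)
  have huw' : 0 < (inner ℝ u' (unitResidual S (n + 1)) : ℝ) := by
    rw [hw' _ hVu']
    exact mul_pos hs0 huw
  refine ⟨⟨huTu, huw'.le, ?_, ?_, hub.le, ?_⟩, ⟨?_, hux, huTu, ?_, hub⟩⟩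
  · rw [hx, inner_add_right]
    exact add_nonneg hux real_inner_self_nonneg
  · rw [real_inner_comm, hw' _ hVx, hx, inner_add_left]
    refine mul_nonneg hs0.le (add_nonneg ?_ huw.le)
    rw [real_inner_comm]; exact hp.w_x
  · rw [real_inner_comm, hw' _ hVb, real_inner_comm]
    exact mul_pos hs0 hp.w_b
  · intro h0
    rw [h0, inner_zero_left] at huw
    exact huw.false
  · rw [← hx, hr, real_inner_smul_right]
    exact mul_pos hφ' huw'

lemma signs (h : IsMinresRun T S b N) (hT : T.IsSymmetric)
    (hc : ∀ n < N, (S n).c * (S (n + 1)).γ₁ < 0) {n : ℕ} (hn : n ≤ N) :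
    Signs T b ((S n).τ • (S n).dir) (unitResidual S n) (S n).x := by
  induction n with
  | zero =>
    have hb : 0 < ‖b‖ := norm_pos_iff.2 h.b_ne
    constructor <;> simp [unitResidual, h.start, minresStart, real_inner_smul_left, h.b_ne]
  | succ n ih => exact (h.signs_succ hT hn (hc n hn) (ih (by lia))).1

lemma goodUpdate (h : IsMinresRun T S b N) (hT : T.IsSymmetric)
    (hc : ∀ n < N, (S n).c * (S (n + 1)).γ₁ < 0) {n : ℕ} (hn : n < N) :
    GoodUpdate T b (S n).x ((S (n + 1)).τ • (S (n + 1)).dir) :=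
  (h.signs_succ hT hn (hc n hn) (h.signs hT hc hn.le)).2

end IsMinresRun

end Run

/-! ### No breakdown before the grade. -/

section Grade

variable {d : ℕ} {A : Matrix (Fin d) (Fin d) ℝ} {b : EuclideanSpace ℝ (Fin d)} {g : ℕ}

lemma krylov_le_of_invariant {P : Submodule ℝ (EuclideanSpace ℝ (Fin d))} (hb : b ∈ P)
    (hP : ∀ y ∈ P, Matrix.toEuclideanLin A y ∈ P) (k : ℕ) : krylov A b k ≤ P := by
  refine Submodule.span_le.2 ?_
  rintro y ⟨i, -, rfl⟩
  change Matrix.toEuclideanLin (A ^ i) b ∈ P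
  induction i with
  | zero => simpa using hb
  | succ i ih =>
    have : Matrix.toEuclideanLin (A ^ (i + 1)) b =
        Matrix.toEuclideanLin A (Matrix.toEuclideanLin (A ^ i) b) := by
      simp [Matrix.toLpLin_apply, pow_succ']
    rw [this]
    exact hP _ ih

lemma IsGrade.ne_zero (hg : IsGrade A b g) : b ≠ 0 := by
  rintro rfl
  have h1 := hg.2 1 le_rfl
  rw [if_pos (Nat.succ_le_of_lt hg.1)] at h1
  have h2 : krylov A 0 1 = ⊥ :=
    le_bot_iff.1 (krylov_le_of_invariant (zero_mem _) (by simp) 1)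
  rw [h2, finrank_bot] at h1
  exact zero_ne_one h1

lemma isMinresRun_minres (hg : IsGrade A b g) {n : ℕ} (hn : n < g) :
    (minres A b n).halted = false ∧
      IsMinresRun (Matrix.toEuclideanLin A) (minres A b) b n := by
  induction n with
  | zero => exact ⟨rfl, rfl, hg.ne_zero, fun n hn => absurd hn n.not_lt_zero⟩
  | succ n ih =>
    obtain ⟨hh, hrun⟩ := ih (by lia)
    rcases minresStep_spec A (minres A b n) hh with ⟨α, hα⟩ | ⟨h1, α, γ₂, h2⟩
    · exfalso
      -- Breakdown would make the span of `n + 1` Lanczos vectors invariant, hence contain a Krylov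
      -- space of dimension `n + 2`.
      have hle : krylov A b (n + 2) ≤ lanczosSpan (minres A b) (n + 1) := by
        refine krylov_le_of_invariant (hrun.b_mem n) (fun y hy => ?_) _
        induction hy using Submodule.span_induction with
        | mem y hy =>
          obtain ⟨i, hi, rfl⟩ := hy
          obtain rfl | hin := (Nat.lt_succ_iff.1 hi).eq_or_lt
          · dsimp only
            rw [hα]
            exact add_mem (Submodule.smul_mem _ _
              (lanczosSpan_mono _ (Nat.le_succ _) (hrun.v_mem le_rfl)))
              (Submodule.smul_mem _ _ (vNext_mem_lanczosSpan _ (Nat.lt_succ_self _)))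
          · exact lanczosSpan_mono _ (by lia) (hrun.apply_vNext_mem hin)
        | zero => rw [map_zero]; exact zero_mem _
        | add y y' _ _ h1 h2 => rw [map_add]; exact add_mem h1 h2
        | smul a y _ h1 => rw [map_smul]; exact Submodule.smul_mem _ _ h1
      have h1 := (Submodule.finrank_mono hle).trans (finrank_lanczosSpan_le _ _)
      rw [hg.2 _ (by lia)] at h1
      split_ifs at h1 <;> lia
    · refine ⟨h1, rfl, hg.ne_zero, fun m hm => ?_⟩
      obtain rfl | hmn := (Nat.lt_succ_iff.1 hm).eq_or_lt
      · exact ⟨α, γ₂, h2⟩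
      · exact hrun.step m hmn

end Grade

/-! ### Monotonicity along a segment. -/

section Monotonicity

open IsMinresRun

variable {d : ℕ} {A : Matrix (Fin d) (Fin d) ℝ} {b x u : EuclideanSpace ℝ (Fin d)}

/-- Using the residual at the endpoint `x + u` makes the `ω`-derivative `-⟪u, b - T (x + u)⟫ + (ω -
1) ⟪u, T u⟫`, which is negative for `ω ≤ 1` when `u` is a good update. -/
lemma quadModel_add_smul (hT : (Matrix.toEuclideanLin A).IsSymmetric) (ω : ℝ) :
    quadModel A b (x + ω • u) = quadModel A b x
      - ω * inner ℝ u (b - Matrix.toEuclideanLin A (x + u))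
      + (ω ^ 2 / 2 - ω) * inner ℝ u (Matrix.toEuclideanLin A u) := by
  have h1 : inner ℝ x (Matrix.toEuclideanLin A u) =
      (inner ℝ u (Matrix.toEuclideanLin A x) : ℝ) := by
    rw [← hT, real_inner_comm]
  have h2 : (inner ℝ b u : ℝ) = inner ℝ u b := real_inner_comm _ _
  simp only [quadModel, map_add, map_smul, inner_add_left, inner_add_right, inner_sub_right,
    real_inner_smul_left, real_inner_smul_right, h1, h2]
  ring

lemma energy_sub (hT : (Matrix.toEuclideanLin A).IsSymmetric) {xs : EuclideanSpace ℝ (Fin d)}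
    (hxs : Matrix.toEuclideanLin A xs = b) (y : EuclideanSpace ℝ (Fin d)) :
    energy A (xs - y) = 2 * quadModel A b y + inner ℝ xs b := by
  have h1 : inner ℝ xs (Matrix.toEuclideanLin A y) = (inner ℝ b y : ℝ) := by
    rw [← hT, hxs]
  have h2 : (inner ℝ y b : ℝ) = inner ℝ b y := real_inner_comm _ _
  simp only [energy, quadModel, map_sub, inner_sub_left, inner_sub_right, hxs, h1, h2]
  ring

lemma IsMinresRun.GoodUpdate.quadModel_strictAntiOn (hT : (Matrix.toEuclideanLin A).IsSymmetric)
    (h : GoodUpdate (Matrix.toEuclideanLin A) b x u) :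
    StrictAntiOn (fun ω : ℝ => quadModel A b (x + ω • u)) (Set.Iic 1) := by
  intro ω₁ h₁ ω₂ h₂ hlt
  simp only [Set.mem_Iic] at h₁ h₂
  simp only [quadModel_add_smul hT]
  have h3 := mul_pos (sub_pos.2 hlt) h.inner_residual
  -- This product is the decrease of `ω ^ 2 / 2 - ω` from `ω₁` to `ω₂`.
  have h4 : 0 ≤ (ω₂ - ω₁) * (1 - (ω₁ + ω₂) / 2) :=
    mul_nonneg (by linarith) (by linarith)
  have h5 := mul_nonneg h4 h.inner_apply
  linarith

lemma IsMinresRun.GoodUpdate.norm_strictMonoOn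
    {T : EuclideanSpace ℝ (Fin d) →ₗ[ℝ] EuclideanSpace ℝ (Fin d)} (h : GoodUpdate T b x u) :
    StrictMonoOn (fun ω : ℝ => ‖x + ω • u‖) (Set.Ici 0) := by
  intro ω₁ h₁ ω₂ h₂ hlt
  simp only [Set.mem_Ici] at h₁ h₂
  refine lt_of_pow_lt_pow_left₀ 2 (norm_nonneg _) ?_
  have h3 := mul_nonneg (sub_pos.2 hlt).le h.inner_x
  have h4 : 0 < (ω₂ - ω₁) * (ω₁ + ω₂) := mul_pos (sub_pos.2 hlt) (by linarith)
  have h5 := mul_pos h4 (real_inner_self_pos.2 h.ne_zero)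
  have h6 : (inner ℝ x u : ℝ) = inner ℝ u x := real_inner_comm _ _
  simp only [← real_inner_self_eq_norm_sq, inner_add_left, inner_add_right,
    real_inner_smul_left, real_inner_smul_right, h6]
  linarith

end Monotonicity

/-! ### Assembly. -/

theorem mainTheorem5 {d : ℕ} (A : Matrix (Fin d) (Fin d) ℝ) (hA : A.IsSymm)
    (b : EuclideanSpace ℝ (Fin d)) (g : ℕ) (hg : IsGrade A b g)
    (K : ℕ) (hK : K < g) (hNPC : ∀ k : ℕ, 1 ≤ k → k ≤ K → ¬ NPCDetected A b k) :
    (∀ xs : EuclideanSpace ℝ (Fin d), Matrix.toEuclideanLin A xs = b →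
      StrictAntiOn (fun k : ℕ => energy A (xs - (minres A b k).x)) (Set.Iic K)) ∧
    (∀ xs : EuclideanSpace ℝ (Fin d), Matrix.toEuclideanLin A xs = b →
      ∀ k : ℕ, 1 ≤ k → k ≤ K →
        StrictAntiOn (fun ω : ℝ => energy A (xs - minresSegment A b k ω)) (Set.Iic 1)) ∧
    StrictAntiOn (fun k : ℕ => quadModel A b (minres A b k).x) (Set.Iic K) ∧
    (∀ k : ℕ, 1 ≤ k → k ≤ K →
      StrictAntiOn (fun ω : ℝ => quadModel A b (minresSegment A b k ω)) (Set.Iic 1)) ∧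
    StrictMonoOn (fun k : ℕ => ‖(minres A b k).x‖) (Set.Iic K) ∧
    (∀ k : ℕ, 1 ≤ k → k ≤ K →
      StrictMonoOn (fun ω : ℝ => ‖minresSegment A b k ω‖) (Set.Ici 0)) ∧
    StrictMonoOn (fun k : ℕ => (inner ℝ (minres A b k).x b : ℝ)) (Set.Iic K) := by
  have hT : (Matrix.toEuclideanLin A).IsSymmetric :=
    Matrix.isSymmetric_toEuclideanLin_iff.2 (by
      rw [Matrix.IsHermitian, Matrix.conjTranspose_eq_transpose_of_trivial]; exact hA)
  have hrun := (isMinresRun_minres hg hK).2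
  have hc : ∀ n < K, (minres A b n).c * (minres A b (n + 1)).γ₁ < 0 := fun n hn =>
    not_le.1 (hNPC (n + 1) (by lia) (by lia))
  have hgood : ∀ n < K, IsMinresRun.GoodUpdate (Matrix.toEuclideanLin A) b (minres A b n).x
      ((minres A b (n + 1)).τ • (minres A b (n + 1)).dir) :=
    fun n hn => hrun.goodUpdate hT hc hn
  -- Consecutive iterates are the points `ω = 0` and `ω = 1` of one segment, so monotonicity in `k`
  -- follows from that in `ω`.
  have hx : ∀ n < K, (minres A b (n + 1)).x = minresSegment A b (n + 1) 1 := fun n hn => by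
    obtain ⟨α, γ₂, hs⟩ := hrun.step n hn
    rw [hs.x_eq, minresSegment, one_mul]
    rfl
  have hx0 : ∀ n, (minres A b n).x = minresSegment A b (n + 1) 0 := fun n => by
    rw [minresSegment, zero_mul, zero_smul, add_zero]
    rfl
  have hseg : ∀ n, minresSegment A b (n + 1) = fun ω => (minres A b n).x +
      ω • ((minres A b (n + 1)).τ • (minres A b (n + 1)).dir) := fun n => by
    funext ω
    rw [minresSegment, mul_smul]
    rfl
  have hm : ∀ n < K, StrictAntiOn (fun ω : ℝ => quadModel A b (minresSegment A b (n + 1) ω))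
      (Set.Iic 1) := fun n hn => by
    rw [hseg]
    exact (hgood n hn).quadModel_strictAntiOn hT
  have hnorm : ∀ n < K, StrictMonoOn (fun ω : ℝ => ‖minresSegment A b (n + 1) ω‖)
      (Set.Ici 0) := fun n hn => by
    rw [hseg]
    exact (hgood n hn).norm_strictMonoOn
  have hmk : StrictAntiOn (fun k : ℕ => quadModel A b (minres A b k).x) (Set.Iic K) := by
    refine strictAntiOn_of_succ_lt Set.ordConnected_Iic fun n _ _ hn => ?_
    have hn' : n < K := hn
    change quadModel A b (minres A b (n + 1)).x < _
    rw [hx n hn', hx0 n]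
    exact hm n hn' (by simp) (by simp) one_pos
  refine ⟨fun xs hxs i hi j hj hij => ?_, fun xs hxs k h1 hk i hi j hj hij => ?_, hmk,
    fun k h1 hk => ?_, ?_, fun k h1 hk => ?_, ?_⟩
  · have := hmk hi hj hij
    simp only [energy_sub hT hxs] at this ⊢
    linarith
  · obtain ⟨n, rfl⟩ : ∃ n, k = n + 1 := ⟨k - 1, by lia⟩
    have := hm n hk hi hj hij
    simp only [energy_sub hT hxs] at this ⊢
    linarith
  · obtain ⟨n, rfl⟩ : ∃ n, k = n + 1 := ⟨k - 1, by lia⟩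
    exact hm n hk
  · refine strictMonoOn_of_lt_succ Set.ordConnected_Iic fun n _ _ hn => ?_
    have hn' : n < K := hn
    change _ < ‖(minres A b (n + 1)).x‖
    rw [hx n hn', hx0 n]
    exact hnorm n hn' (by simp) (by simp) one_pos
  · obtain ⟨n, rfl⟩ : ∃ n, k = n + 1 := ⟨k - 1, by lia⟩
    exact hnorm n hk
  · refine strictMonoOn_of_lt_succ Set.ordConnected_Iic fun n _ _ hn => ?_
    have hn' : n < K := hn
    obtain ⟨α, γ₂, hs⟩ := hrun.step n hn'
    change _ < (inner ℝ (minres A b (n + 1)).x b : ℝ)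
    rw [hs.x_eq, inner_add_left]
    exact lt_add_of_pos_right _ (hgood n hn').inner_b
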